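/- For each $n$ let $\Delta=\Delta_n\in\mathbb{R}^{r_n\times n}$ be an arbitrary matrix, let $\epsilon\sim\mathcal{N}(0,\sigma^2 I_n)$ with $\sigma$ fixed, and put $\mathcal{S}_\Delta(1)=\{x\in\mathrm{row}(\Delta):\|\Delta x\|_1\le 1\}$. For $\delta>0$ let $N(\delta,\mathcal{S}_\Delta(1),\|\cdot\|_2)$ be the fewest number of Euclidean balls of radius $\delta$ that cover $\mathcal{S}_\Delta(1)$. Suppose that there exist a constant $w<2$ and a sequence $E=E_n$ such that, for all $n$ large enough, $$\log N(\delta,\mathcal{S}_\Delta(1),\|\cdot\|_2)\le E\Big(\frac{\sqrt n}{\delta}\Big)^w\qquad\text{for all }\delta>0 .$$ Then $$\sup_{x\in\mathcal{S}_\Delta(1)}\frac{\epsilon^\top x}{\|x\|_2^{1-w/2}}=O_{\mathbb{P}}\big(\sqrt{E}\,n^{w/4}\big)\qquad(\text{with }0/0=0).$$ As a result, let $\beta_0=\beta_{0,n}\in\mathbb{R}^n$ be such that $\Delta\beta_0\neq 0$ for all large $n$, let $y=\beta_0+\epsilon$, and let $$\hat\beta=\operatorname*{argmin}_{\beta\in\mathbb{R}^n}\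 \tfrac12\|y-\beta\|_2^2+\lambda\|\Delta\beta\|_1$$ be the generalized lasso estimate with any deterministic tuning parameters $\lambda=\lambda_n\ge 0$ satisfying $$\lambda=\Theta\Big(E^{\frac{1}{1+w/2}}\,n^{\frac{w/2}{1+w/2}}\,\|\Delta\beta_0\|_1^{-\frac{1-w/2}{1+w/2}}\Big).$$ Then $$\frac{\|\hat\beta-\beta_0\|_2^2}{n}=O_{\mathbb{P}}\Big(\frac{\mathrm{nullity}(\Delta)}{n}+E^{\frac{1}{1+w/2}}\,n^{-\frac{1}{1+w/2}}\,\|\Delta\beta_0\|_1^{\frac{w}{1+w/2}}\Big),$$ where $\mathrm{nullity}(\Delta)$ is the dimension of the null space of $\Delta$. Here $X_n=O_{\mathbb{P}}(a_n)$ means that for every $\eta>0$ there is a constant $C>0$ with $\mathbb{P}(|X_n|>C a_n)\le\eta$ for all large $n$. -/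

import Mathlib

open MeasureTheory ProbabilityTheory Filter Asymptotics
open scoped ENNReal NNReal Topology

noncomputable section

namespace GenLasso

/-- The `ℓ₁` norm `‖Δ x‖₁ = ∑ᵢ |(Δ x)ᵢ|` of `Δ x`. -/
def l1 {r n : ℕ} (Δ : Matrix (Fin r) (Fin n) ℝ) (x : EuclideanSpace ℝ (Fin n)) : ℝ :=
  ∑ i, |Δ.mulVec x.ofLp i|

/-- The set `S_Δ(ρ) = {x ∈ row(Δ) : ‖Δ x‖₁ ≤ ρ}`, where `row(Δ)` is the row space of `Δ`. -/
def rowBall {r n : ℕ} (Δ : Matrix (Fin r) (Fin n) ℝ) (ρ : ℝ) : Set (EuclideanSpace ℝ (Fin n)) :=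
  {x | x.ofLp ∈ Submodule.span ℝ (Set.range Δ.row) ∧ l1 Δ x ≤ ρ}

/-- The dimension of the null space of `Δ`. -/
def nullity {r n : ℕ} (Δ : Matrix (Fin r) (Fin n) ℝ) : ℕ :=
  Module.finrank ℝ (LinearMap.ker Δ.mulVecLin)

/-- The entropy number `log N(δ, A, ‖·‖₂)`, as an extended real number, where `N(δ, A, ‖·‖₂)` is the
fewest number of Euclidean balls of radius `δ` (with centers anywhere) that cover `A`. -/
def entropy {n : ℕ} (δ : ℝ≥0) (A : Set (EuclideanSpace ℝ (Fin n))) : EReal :=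
  ENNReal.log ((Metric.externalCoveringNumber δ A : ℕ∞) : ℝ≥0∞)

/-- `b` is a generalized lasso estimate for the data `y`, the penalty operator `Δ` and the tuning
parameter `lam`: it minimizes `½ ‖y - β‖₂² + lam ‖Δ β‖₁` over all `β ∈ ℝⁿ`. -/
def IsEstimate {r n : ℕ} (Δ : Matrix (Fin r) (Fin n) ℝ) (lam : ℝ) (y b : EuclideanSpace ℝ (Fin n)) :
    Prop :=
  IsMinOn (fun β : EuclideanSpace ℝ (Fin n) => 1 / 2 * ‖y - β‖ ^ 2 + lam * l1 Δ β) Set.univ b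

/-- The supremum over `x ∈ S_Δ(1)` of `⟨e, x⟩ / ‖x‖₂ ^ p`, with values in `[0, ∞]`. The point
`x = 0` contributes the value `0 / 0 = 0`, and as `S_Δ(1)` is symmetric under `x ↦ -x` the supremum
over the other points is nonnegative, so that passing from real numbers to `[0, ∞]` loses nothing. -/
def fracSup {r n : ℕ} (Δ : Matrix (Fin r) (Fin n) ℝ) (p : ℝ) (e : EuclideanSpace ℝ (Fin n)) :
    ℝ≥0∞ :=
  ⨆ x ∈ rowBall Δ 1, ENNReal.ofReal (inner ℝ e x / ‖x‖ ^ p)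

/-- `X n = O_ℙ(a n)` as `n → ∞`: for each `η > 0` there is a constant `C` such that
`ℙ(|X n| > C * a n) ≤ η` for all large `n`. The variable `X n` lives on a probability space of its
own and is real-valued or takes its values in `[0, ∞]`; the sequence `a` is deterministic and
nonnegative. -/
def IsBigOP {Ω : ℕ → Type*} [∀ n, MeasurableSpace (Ω n)] (P : ∀ n, Measure (Ω n))
    {F : Type*} [ENorm F] (X : ∀ n, Ω n → F) (a : ℕ → ℝ) : Prop :=
  ∀ η : ℝ≥0∞, 0 < η → ∃ C : ℝ, 0 < C ∧
    ∀ᶠ n in atTop, P n {ω | ENNReal.ofReal (C * a n) < ‖X n ω‖ₑ} ≤ η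

end GenLasso

end

/-!
The proof is one chaining argument followed by one deterministic inequality.

*The fractional bound.* If `Δ ≠ 0`, the unit ball `S` of the penalty contains a segment, so its
covering numbers are unbounded and the entropy hypothesis forces `0 < w` and `0 < E`
(`exponent_pos_and_const_pos`). Let `D = √n (2 E) ^ (1 / w)`. At scale `D` the entropy is below
`log 2`, so by symmetry `S` lies in the ball of radius `D` around `0`; at scale `D 2⁻ʲ` there is a
net of at most `exp (2 ^ (w j))` points. For `x ∈ S` with `‖x‖` of order `D 2⁻ᵏ`, take the chain that
is `0` at level `k` and then follows the nets at the levels `j > k`. Its increments at level `j` are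
of order `D 2⁻ʲ`, hence, by the Gaussian tail and a union bound over all pairs of net points at
all levels, `⟨ε, x⟩` is at most a constant times `∑_{j ≥ k} D 2⁻ʲ 2 ^ (w j / 2)`, a geometric series
comparable to `D ^ (w / 2) ‖x‖ ^ (1 - w / 2)`. As `0` is used as the starting point at every level,
no separate peeling over the norm of `x` is needed. The failure probabilities sum to a
quantity that depends on neither `n` nor `Δ` (`exists_const_measure_inner_gt_le`,
`exists_const_measure_fracSup_gt_le`).

*The error rate.* Comparing the objective at the estimate and at `β₀` and splitting the noise along
`row(Δ)` and its orthogonal complement gives, for `u = ‖β̂ - β₀‖`, `a = ‖Δ β₀‖₁`, `b = ‖Δ β̂‖₁`,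
`½ u² ≤ g u + K u ^ (1 - w / 2) (a + b) ^ (w / 2) + λ (a - b)` (`basic_inequality`), where `g` is the
norm of the projection of `ε` to the complement and `K` is of order `√E n ^ (w / 4)`. With `R = n` times
the second term of the rate one has `λ a ≍ R`, and `K` is of order
`R ^ ((1 + w / 2) / 2) a ^ (-w / 2)`; Young's inequality with a small weight on `R (a + b) / a` lets the
penalty absorb the growth in `b` and leaves `u² ≤ 8 g² + C R` (`exists_const_sq_le`). Finally
`𝔼 g² ≤ σ² nullity(Δ)` (`measure_sq_norm_proj_gaussian`).
-/

namespace GenLasso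

/-! ### Linear functionals and projections of Gaussian noise -/

lemma hasLaw_inner_gaussian {Ω : Type*} [MeasurableSpace Ω] {P : Measure Ω} {n : ℕ} {σ : ℝ}
    {ε : Ω → EuclideanSpace ℝ (Fin n)}
    (hε : HasLaw ε (multivariateGaussian 0 (σ ^ 2 • (1 : Matrix (Fin n) (Fin n) ℝ))) P)
    (v : EuclideanSpace ℝ (Fin n)) :
    HasLaw (fun ω => inner ℝ (ε ω) v) (gaussianReal 0 (σ ^ 2 * ‖v‖ ^ 2).toNNReal) P := by
  have hS : (σ ^ 2 • (1 : Matrix (Fin n) (Fin n) ℝ)).PosSemidef :=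
    Matrix.PosSemidef.one.smul (sq_nonneg σ)
  set μ := multivariateGaussian (0 : EuclideanSpace ℝ (Fin n))
    (σ ^ 2 • (1 : Matrix (Fin n) (Fin n) ℝ)) with hμ
  have h1 : HasLaw (fun x : EuclideanSpace ℝ (Fin n) => inner ℝ v x)
      (gaussianReal 0 (σ ^ 2 * ‖v‖ ^ 2).toNNReal) μ := by
    refine ⟨by fun_prop, ?_⟩
    have h := IsGaussian.map_eq_gaussianReal (μ := μ) (innerSL ℝ v)
    have hmean : μ[(innerSL ℝ v : EuclideanSpace ℝ (Fin n) → ℝ)] = 0 := by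
      rw [ContinuousLinearMap.integral_comp_id_comm, hμ, integral_id_multivariateGaussian]
      · simp
      · exact IsGaussian.integrable_id
    have hvar : Var[(innerSL ℝ v : EuclideanSpace ℝ (Fin n) → ℝ); μ] = σ ^ 2 * ‖v‖ ^ 2 := by
      have := covarianceBilin_self (μ := μ) IsGaussian.memLp_two_id v
      rw [hμ, covarianceBilin_multivariateGaussian hS] at this
      rw [← hμ] at this
      change Var[fun u => inner ℝ v u; μ] = _
      rw [← this, Matrix.smul_mulVec, Matrix.one_mulVec, dotProduct_smul, smul_eq_mul,
        EuclideanSpace.real_norm_sq_eq]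
      simp [dotProduct, sq]
    rw [hmean, hvar] at h
    exact h
  have := h1.comp hε
  refine this.congr (ae_of_all _ fun ω => ?_)
  simp [real_inner_comm]

/-- The Gaussian tail bound, with the standard deviation replaced by any upper bound `s * ρ`. -/
lemma measure_le_inner_gaussian {Ω : Type*} [MeasurableSpace Ω] {P : Measure Ω}
    [IsProbabilityMeasure P] {n : ℕ} {σ s : ℝ}
    {ε : Ω → EuclideanSpace ℝ (Fin n)}
    (hε : HasLaw ε (multivariateGaussian 0 (σ ^ 2 • (1 : Matrix (Fin n) (Fin n) ℝ))) P)
    (hs : 0 < s) (hσ : |σ| ≤ s) {v : EuclideanSpace ℝ (Fin n)} {ρ u : ℝ} (hρ : 0 < ρ) (hu : 0 ≤ u)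
    (hv : ‖v‖ ≤ ρ) :
    P {ω | u * ρ ≤ inner ℝ (ε ω) v} ≤ ENNReal.ofReal (Real.exp (-u ^ 2 / (2 * s ^ 2))) := by
  have hX := hasLaw_inner_gaussian hε v
  have hvar : σ ^ 2 * ‖v‖ ^ 2 ≤ s ^ 2 * ρ ^ 2 := by
    have : σ ^ 2 ≤ s ^ 2 := sq_le_sq.2 (by rwa [abs_of_pos hs])
    gcongr
  have hsub : HasSubgaussianMGF (fun ω => inner ℝ (ε ω) v) (s ^ 2 * ρ ^ 2).toNNReal P := by
    have hid : HasSubgaussianMGF id (s ^ 2 * ρ ^ 2).toNNReal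
        (P.map (fun ω => inner ℝ (ε ω) v)) := by
      rw [hX.map_eq]
      refine ⟨fun t => by simpa using integrable_exp_mul_gaussianReal t, fun t => ?_⟩
      rw [mgf_id_gaussianReal]
      simp only [zero_mul, zero_add]
      rw [Real.coe_toNNReal _ (by positivity), Real.coe_toNNReal _ (by positivity)]
      gcongr
    exact (HasSubgaussianMGF.id_map_iff hX.aemeasurable).1 hid
  have := hsub.measure_ge_le (ε := u * ρ) (by positivity)
  rw [Real.coe_toNNReal _ (by positivity)] at this
  rw [← ENNReal.ofReal_toReal (measure_ne_top P _)]
  refine ENNReal.ofReal_le_ofReal (this.trans_eq ?_)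
  congr 1
  field_simp

lemma integral_inner_sq_gaussian {Ω : Type*} [MeasurableSpace Ω] {P : Measure Ω} {n : ℕ} {σ : ℝ}
    {ε : Ω → EuclideanSpace ℝ (Fin n)}
    (hε : HasLaw ε (multivariateGaussian 0 (σ ^ 2 • (1 : Matrix (Fin n) (Fin n) ℝ))) P)
    (v : EuclideanSpace ℝ (Fin n)) :
    Integrable (fun ω => inner ℝ (ε ω) v ^ 2) P ∧
      ∫ ω, inner ℝ (ε ω) v ^ 2 ∂P = σ ^ 2 * ‖v‖ ^ 2 := by
  have hX := hasLaw_inner_gaussian hε v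
  set V := (σ ^ 2 * ‖v‖ ^ 2).toNNReal
  have hm : MemLp (id : ℝ → ℝ) 2 (gaussianReal 0 V) := memLp_id_gaussianReal 2
  have hi : Integrable (fun x : ℝ => x ^ 2) (gaussianReal 0 V) := hm.integrable_sq
  constructor
  · have : Integrable (fun x : ℝ => x ^ 2) (P.map (fun ω => inner ℝ (ε ω) v)) := by
      rwa [hX.map_eq]
    exact this.comp_aemeasurable hX.aemeasurable
  · have h1 : ∫ ω, inner ℝ (ε ω) v ^ 2 ∂P = ∫ x, x ^ 2 ∂(gaussianReal 0 V) := by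
      rw [← hX.map_eq, integral_map hX.aemeasurable (by fun_prop)]
    have h2 := variance_of_integral_eq_zero (X := (id : ℝ → ℝ)) (μ := gaussianReal 0 V)
      aemeasurable_id (by simp)
    rw [variance_id_gaussianReal] at h2
    rw [h1]
    simp only [id] at h2
    rw [← h2]
    exact Real.coe_toNNReal _ (by positivity)

/-- The squared projection of the noise onto a `d`-dimensional subspace has mean `σ² d`, so it is
at most `C d` outside an event of probability `σ² / C`. -/
lemma measure_sq_norm_proj_gaussian {Ω : Type*} [MeasurableSpace Ω] {P : Measure Ω}
    [IsProbabilityMeasure P] {n : ℕ} {σ : ℝ} {ε : Ω → EuclideanSpace ℝ (Fin n)}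
    (hε : HasLaw ε (multivariateGaussian 0 (σ ^ 2 • (1 : Matrix (Fin n) (Fin n) ℝ))) P)
    (K : Submodule ℝ (EuclideanSpace ℝ (Fin n))) {C : ℝ} (hC : 0 < C) :
    P {ω | C * Module.finrank ℝ K < ‖K.starProjection (ε ω)‖ ^ 2}
      ≤ ENNReal.ofReal (σ ^ 2 / C) := by
  set d := Module.finrank ℝ K with hd
  let b := stdOrthonormalBasis ℝ K
  have hnorm : ∀ x, ‖K.starProjection x‖ ^ 2
      = ∑ i, inner ℝ x (b i : EuclideanSpace ℝ (Fin n)) ^ 2 := by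
    intro x
    have := b.sum_sq_norm_inner_right (K.orthogonalProjectionOnto x)
    rw [Submodule.starProjection_apply, ← Submodule.coe_norm, ← this]
    refine Finset.sum_congr rfl fun i _ => ?_
    rw [Submodule.coe_inner, Real.norm_eq_abs, sq_abs, ← Submodule.starProjection_apply,
      ← Submodule.inner_starProjection_left_eq_right,
      Submodule.starProjection_eq_self_iff.2 (b i).2, real_inner_comm]
  rcases Nat.eq_zero_or_pos d with h0 | hpos
  · have hK : K = ⊥ := Submodule.finrank_eq_zero.1 (hd ▸ h0)
    have : {ω | C * (d : ℝ) < ‖K.starProjection (ε ω)‖ ^ 2} = ∅ := by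
      ext ω
      simp [h0, hK]
    rw [this]
    simp
  · have hint : Integrable (fun ω => ‖K.starProjection (ε ω)‖ ^ 2) P := by
      simp_rw [hnorm]
      exact integrable_finsetSum _ fun i _ => (integral_inner_sq_gaussian hε _).1
    have hval : ∫ ω, ‖K.starProjection (ε ω)‖ ^ 2 ∂P = σ ^ 2 * d := by
      simp_rw [hnorm]
      rw [integral_finsetSum _ fun i _ => (integral_inner_sq_gaussian hε _).1]
      simp_rw [(integral_inner_sq_gaussian hε _).2]
      have : ∀ i, ‖(b i : EuclideanSpace ℝ (Fin n))‖ = 1 := fun i => b.orthonormal.1 i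
      simp [this, mul_comm, hd]
    have hdr : (0 : ℝ) < d := by exact_mod_cast hpos
    have hM := mul_meas_ge_le_integral_of_nonneg (μ := P)
      (ae_of_all _ fun ω => sq_nonneg ‖K.starProjection (ε ω)‖) hint (C * d)
    rw [hval] at hM
    have h3 : P.real {ω | C * d ≤ ‖K.starProjection (ε ω)‖ ^ 2} ≤ σ ^ 2 / C := by
      rw [le_div_iff₀ hC]
      nlinarith
    calc P {ω | C * d < ‖K.starProjection (ε ω)‖ ^ 2}
        ≤ P {ω | C * d ≤ ‖K.starProjection (ε ω)‖ ^ 2} :=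
          by
          gcongr with ω
          exact le_of_lt
      _ = ENNReal.ofReal (P.real {ω | C * d ≤ ‖K.starProjection (ε ω)‖ ^ 2}) := by
          rw [measureReal_def, ENNReal.ofReal_toReal (measure_ne_top P _)]
      _ ≤ _ := ENNReal.ofReal_le_ofReal h3

/-! ### Chaining along dyadic nets -/

/-- Deterministic part of the chaining argument. Start the chain of net points at `0` on the scale
`D 2⁻ᵏ` comparable to `‖x‖`: the increments then add up to a multiple of `‖x‖ ^ (1 - q)`. -/
lemma inner_le_of_increments_le {V : Type*} [NormedAddCommGroup V] [InnerProductSpace ℝ V]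
    {q M D : ℝ} (hq1 : q < 1) (hM : 0 < M) (hD : 0 < D) {S : Set V}
    (hS : ∀ x ∈ S, ‖x‖ ≤ D) {T : ℕ → Set V}
    (hT : ∀ j, ∀ x ∈ S, ∃ t ∈ T j, ‖x - t‖ ≤ D * (1 / 2) ^ j) {e : V}
    (he : ∀ j, ∀ a ∈ insert 0 (T (j + 1)), ∀ b ∈ insert 0 (T j),
      ‖a - b‖ ≤ 2 * (D * (1 / 2) ^ j) →
        inner ℝ e (a - b) ≤ M * (2 ^ q) ^ (j + 1) * (2 * (D * (1 / 2) ^ j)))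
    {x : V} (hx : x ∈ S) :
    inner ℝ e x ≤ (2 * M * 2 ^ q * 2 ^ (1 - q) / (1 - 2 ^ q / 2)) * D ^ q * ‖x‖ ^ (1 - q) := by
  have h2q : (0 : ℝ) < 2 ^ q := by positivity
  have hθ1 : (2 : ℝ) ^ q / 2 < 1 := by
    rw [div_lt_one two_pos]
    exact (Real.rpow_lt_rpow_of_exponent_lt one_lt_two hq1).trans_eq (Real.rpow_one 2)
  set θ : ℝ := 2 ^ q / 2 with hθ
  have hθ0 : 0 < θ := by positivity
  have h1θ : 0 < 1 - θ := by linarith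
  rcases eq_or_ne x 0 with rfl | hx0
  · simp only [inner_zero_right]
    positivity
  have hxpos : 0 < ‖x‖ := norm_pos_iff.2 hx0
  -- the scale `k` with `D 2⁻⁽ᵏ⁺¹⁾ < ‖x‖ ≤ D 2⁻ᵏ`
  obtain ⟨k, hk1, hk2⟩ : ∃ k : ℕ, (1 / 2 : ℝ) ^ (k + 1) < ‖x‖ / D ∧ ‖x‖ / D ≤ (1 / 2) ^ k :=
    exists_nat_pow_near_of_lt_one (by positivity) ((div_le_one hD).2 (hS x hx)) (by norm_num)
      (by norm_num)
  rw [lt_div_iff₀ hD, mul_comm] at hk1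
  rw [div_le_iff₀ hD, mul_comm] at hk2
  choose π hπT hπ using fun j => hT j x hx
  let t : ℕ → V := fun m => if m = 0 then 0 else π (k + m)
  have htT : ∀ m, t m ∈ insert 0 (T (k + m)) := by
    intro m
    by_cases h : m = 0
    · simp [t, h]
    · simp [t, h, hπT]
  have htx : ∀ m, ‖x - t m‖ ≤ D * (1 / 2) ^ (k + m) := by
    intro m
    by_cases h : m = 0
    · simpa [t, h] using hk2
    · simpa [t, h] using hπ (k + m)
  have hstep : ∀ m, inner ℝ e (t (m + 1) - t m) ≤ 2 * M * 2 ^ q * D * θ ^ k * θ ^ m := by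
    intro m
    have h1 : ‖t (m + 1) - t m‖ ≤ 2 * (D * (1 / 2) ^ (k + m)) := by
      have e1 : t (m + 1) - t m = (x - t m) - (x - t (m + 1)) := by abel
      have e2 := htx (m + 1)
      have e3 := htx m
      have e4 : D * (1 / 2 : ℝ) ^ (k + (m + 1)) ≤ D * (1 / 2) ^ (k + m) := by
        gcongr 1
        exact pow_le_pow_of_le_one (by norm_num) (by norm_num) (by omega)
      rw [e1]
      linarith [norm_sub_le (x - t m) (x - t (m + 1))]
    refine (he (k + m) _ (htT (m + 1)) _ (htT m) h1).trans_eq ?_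
    rw [mul_assoc _ (θ ^ k), ← pow_add, hθ, div_pow, div_pow, one_pow, pow_succ]
    ring
  have hsum : ∀ m, inner ℝ e (t m) ≤ 2 * M * 2 ^ q * D * θ ^ k / (1 - θ) := by
    intro m
    have h1 : inner ℝ e (t m) = ∑ i ∈ Finset.range m, inner ℝ e (t (i + 1) - t i) := by
      rw [← inner_sum, Finset.sum_range_sub]
      simp [t]
    rw [h1]
    calc ∑ i ∈ Finset.range m, inner ℝ e (t (i + 1) - t i)
        ≤ ∑ i ∈ Finset.range m, 2 * M * 2 ^ q * D * θ ^ k * θ ^ i :=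
          Finset.sum_le_sum fun i _ => hstep i
      _ = 2 * M * 2 ^ q * D * θ ^ k * ∑ i ∈ Finset.range m, θ ^ i := by rw [Finset.mul_sum]
      _ ≤ 2 * M * 2 ^ q * D * θ ^ k * (1 - θ)⁻¹ := by
          gcongr
          rw [← tsum_geometric_of_lt_one hθ0.le hθ1]
          exact (summable_geometric_of_lt_one hθ0.le hθ1).sum_le_tsum _
            fun i _ => by positivity
      _ = _ := by rw [div_eq_mul_inv]
  have hlim : Tendsto t atTop (𝓝 x) := by
    rw [tendsto_iff_norm_sub_tendsto_zero]
    have h0 : Tendsto (fun m : ℕ => D * (1 / 2 : ℝ) ^ (k + m)) atTop (𝓝 0) := by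
      have h := (tendsto_pow_atTop_nhds_zero_of_lt_one (r := (1 / 2 : ℝ)) (by norm_num)
        (by norm_num)).const_mul (D * (1 / 2) ^ k)
      rw [mul_zero] at h
      refine h.congr fun m => ?_
      rw [pow_add, mul_assoc]
    exact squeeze_zero (fun _ => norm_nonneg _)
      (fun m => (norm_sub_rev _ _).trans_le (htx m)) h0
  have hfin : inner ℝ e x ≤ 2 * M * 2 ^ q * D * θ ^ k / (1 - θ) :=
    le_of_tendsto (tendsto_const_nhds.inner hlim) (Eventually.of_forall hsum)
  refine hfin.trans ?_
  -- `θ ^ k` is the `(1 - q)`-th power of the scale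
  have hkey : D * θ ^ k ≤ 2 ^ (1 - q) * (D ^ q * ‖x‖ ^ (1 - q)) := by
    have e1 : θ = (1 / 2 : ℝ) ^ (1 - q) := by
      rw [hθ, Real.div_rpow one_pos.le two_pos.le, Real.one_rpow, Real.rpow_sub two_pos,
        Real.rpow_one]
      field_simp
    have e2 : θ ^ k = ((1 / 2 : ℝ) ^ k) ^ (1 - q) := by
      rw [e1, ← Real.rpow_natCast, ← Real.rpow_natCast, ← Real.rpow_mul (by norm_num),
        ← Real.rpow_mul (by norm_num), mul_comm]
    have e3 : D = D ^ q * D ^ (1 - q) := by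
      rw [← Real.rpow_add hD]
      simp
    have e4 : D * (1 / 2 : ℝ) ^ k ≤ 2 * ‖x‖ := by
      rw [pow_succ] at hk1
      linarith
    calc D * θ ^ k = D ^ q * (D * (1 / 2) ^ k) ^ (1 - q) := by
          rw [Real.mul_rpow hD.le (by positivity), ← e2, ← mul_assoc, ← e3]
      _ ≤ D ^ q * (2 * ‖x‖) ^ (1 - q) := by
          gcongr
      _ = _ := by
          rw [Real.mul_rpow two_pos.le hxpos.le]
          ring
  calc 2 * M * 2 ^ q * D * θ ^ k / (1 - θ) = 2 * M * 2 ^ q / (1 - θ) * (D * θ ^ k) := by ring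
    _ ≤ 2 * M * 2 ^ q / (1 - θ) * (2 ^ (1 - q) * (D ^ q * ‖x‖ ^ (1 - q))) := by gcongr
    _ = _ := by ring

/-- The union bound on one scale: the number of pairs of net points, each net augmented by `0`, is at
most `exp (4 h)` and is absorbed by the Gaussian tail. -/
lemma card_mul_tail_le {s L h N₁ N₂ h₁ : ℝ} (hs : 0 < s) (hL : 0 < L) (hh₁ : 1 ≤ h₁) (hh : h₁ ≤ h)
    (hN₁ : N₁ ≤ Real.exp h) (hN₂0 : 0 ≤ N₂) (hN₂ : N₂ ≤ Real.exp h₁) :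
    (N₁ + 1) * (N₂ + 1) * Real.exp (-((s * √(2 * (4 + L))) ^ 2 * h) / (2 * s ^ 2))
      ≤ Real.exp (-(L * h)) := by
  have key : ∀ y : ℝ, 1 ≤ y → y ≤ h → Real.exp y + 1 ≤ Real.exp (2 * h) := by
    intro y hy1 hyh
    have e1 : (1 : ℝ) ≤ Real.exp y := Real.one_le_exp (by linarith)
    have e2 : (2 : ℝ) ≤ Real.exp y := by linarith [Real.add_one_le_exp y]
    have e3 : Real.exp (2 * y) = Real.exp y * Real.exp y := by rw [← Real.exp_add]; ring_nf
    have e4 : Real.exp (2 * y) ≤ Real.exp (2 * h) := Real.exp_le_exp.2 (by linarith)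
    nlinarith
  have e1 := key h (hh₁.trans hh) le_rfl
  have e2 := key h₁ hh₁ hh
  have e3 : -((s * √(2 * (4 + L))) ^ 2 * h) / (2 * s ^ 2) = -((4 + L) * h) := by
    rw [mul_pow, Real.sq_sqrt (by linarith)]
    field_simp
  rw [e3]
  calc (N₁ + 1) * (N₂ + 1) * Real.exp (-((4 + L) * h))
      ≤ Real.exp (2 * h) * Real.exp (2 * h) * Real.exp (-((4 + L) * h)) := by
        gcongr
        · linarith
        · linarith
    _ = Real.exp (-(L * h)) := by
        rw [← Real.exp_add, ← Real.exp_add]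
        ring_nf

/-- Chaining bound for a set `S` inside the ball of radius `D` that has a net of at most
`exp (2 ^ (2 q j))` points at each scale `D 2⁻ʲ`. A process with Gaussian tails is bounded on `S` by a
multiple of `D ^ q ‖x‖ ^ (1 - q)`, with a constant that depends only on `q`, on the noise level and on
the exceptional probability. -/
lemma exists_const_measure_inner_gt_le {q s η : ℝ} (hq0 : 0 < q) (hq1 : q < 1) (hs : 0 < s)
    (hη : 0 < η) :
    ∃ C : ℝ, 0 < C ∧ ∀ {Ω : Type*} [MeasurableSpace Ω] (P : Measure Ω)
      {V : Type*} [NormedAddCommGroup V] [InnerProductSpace ℝ V] (ε : Ω → V)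
      (_ : ∀ (v : V) (ρ u : ℝ), 0 < ρ → 0 ≤ u → ‖v‖ ≤ ρ →
        P {ω | u * ρ ≤ inner ℝ (ε ω) v} ≤ ENNReal.ofReal (Real.exp (-u ^ 2 / (2 * s ^ 2))))
      (D : ℝ) (_ : 0 < D) (S : Set V) (_ : ∀ x ∈ S, ‖x‖ ≤ D) (T : ℕ → Finset V)
      (_ : ∀ j, ((T j).card : ℝ) ≤ Real.exp (((2 : ℝ) ^ (2 * q)) ^ j))
      (_ : ∀ j, ∀ x ∈ S, ∃ t ∈ T j, ‖x - t‖ ≤ D * (1 / 2) ^ j),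
      P {ω | ∃ x ∈ S, C * D ^ q * ‖x‖ ^ (1 - q) < inner ℝ (ε ω) x} ≤ ENNReal.ofReal η := by
  classical
  set B : ℝ := 2 ^ (2 * q) with hB
  have hB1 : 1 < B := Real.one_lt_rpow one_lt_two (by linarith)
  -- the failure probabilities on the scales are dominated by a geometric series of small ratio
  obtain ⟨L, hL, hLη⟩ : ∃ L : ℝ, 0 < L ∧ Real.exp (-(L * (B - 1))) ≤ min (1 / 2) (η / 2) := by
    have h1 : Tendsto (fun L : ℝ => Real.exp (-(L * (B - 1)))) atTop (𝓝 0) :=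
      Real.tendsto_exp_neg_atTop_nhds_zero.comp
        (tendsto_id.atTop_mul_const (by linarith))
    have h2 := h1.eventually_le_const (show (0 : ℝ) < min (1 / 2) (η / 2) by positivity)
    obtain ⟨L, h3, h4⟩ := (h2.and (eventually_gt_atTop 0)).exists
    exact ⟨L, h4, h3⟩
  set ρ := Real.exp (-(L * (B - 1))) with hρ
  have hρ0 : 0 < ρ := Real.exp_pos _
  have hρ2 : ρ ≤ 1 / 2 := hLη.trans (min_le_left _ _)
  set M : ℝ := s * √(2 * (4 + L)) with hM
  have hM0 : 0 < M := by positivity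
  have hθ1 : (2 : ℝ) ^ q / 2 < 1 := by
    rw [div_lt_one two_pos]
    exact (Real.rpow_lt_rpow_of_exponent_lt one_lt_two hq1).trans_eq (Real.rpow_one 2)
  have h1θ : 0 < 1 - (2 : ℝ) ^ q / 2 := by linarith
  refine ⟨2 * M * 2 ^ q * 2 ^ (1 - q) / (1 - 2 ^ q / 2), by positivity, ?_⟩
  intro Ω _ P V _ _ ε htail D hD S hS T hcard hT
  let bad : ℕ → Set Ω := fun j =>
    ⋃ a ∈ insert 0 (T (j + 1)), ⋃ b ∈ insert 0 (T j),
      {ω | ‖a - b‖ ≤ 2 * (D * (1 / 2) ^ j) ∧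
        M * (2 ^ q) ^ (j + 1) * (2 * (D * (1 / 2) ^ j)) ≤ inner ℝ (ε ω) (a - b)}
  have hbad : ∀ j, P (bad j) ≤ ENNReal.ofReal (ρ * ρ ^ j) := by
    intro j
    have hone : ∀ a b : V, P {ω | ‖a - b‖ ≤ 2 * (D * (1 / 2) ^ j) ∧
        M * (2 ^ q) ^ (j + 1) * (2 * (D * (1 / 2) ^ j)) ≤ inner ℝ (ε ω) (a - b)}
        ≤ ENNReal.ofReal (Real.exp (-(M ^ 2 * B ^ (j + 1)) / (2 * s ^ 2))) := by
      intro a b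
      by_cases hab : ‖a - b‖ ≤ 2 * (D * (1 / 2) ^ j)
      · have h := htail (a - b) (2 * (D * (1 / 2) ^ j)) (M * (2 ^ q) ^ (j + 1)) (by positivity)
          (by positivity) hab
        have hsq : (M * ((2 : ℝ) ^ q) ^ (j + 1)) ^ 2 = M ^ 2 * B ^ (j + 1) := by
          rw [mul_pow, ← pow_mul, mul_comm (j + 1) 2, pow_mul, hB, mul_comm 2 q,
            Real.rpow_mul two_pos.le, Real.rpow_two]
        rw [hsq] at h
        simpa only [hab, true_and] using h
      · simp only [hab, false_and, Set.ofPred_false, measure_empty, zero_le]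
    calc P (bad j)
        ≤ ∑ a ∈ insert 0 (T (j + 1)), ∑ b ∈ insert 0 (T j),
            ENNReal.ofReal (Real.exp (-(M ^ 2 * B ^ (j + 1)) / (2 * s ^ 2))) := by
          refine (measure_biUnion_finset_le _ _).trans (Finset.sum_le_sum fun a _ => ?_)
          exact (measure_biUnion_finset_le _ _).trans (Finset.sum_le_sum fun b _ => hone a b)
      _ = ENNReal.ofReal (((insert 0 (T (j + 1))).card : ℝ) * ((insert 0 (T j)).card : ℝ) *
            Real.exp (-(M ^ 2 * B ^ (j + 1)) / (2 * s ^ 2))) := by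
          rw [Finset.sum_const, Finset.sum_const, nsmul_eq_mul, nsmul_eq_mul, ← mul_assoc,
            ENNReal.ofReal_mul (by positivity), ENNReal.ofReal_mul (by positivity),
            ENNReal.ofReal_natCast, ENNReal.ofReal_natCast]
      _ ≤ ENNReal.ofReal (ρ * ρ ^ j) := by
          refine ENNReal.ofReal_le_ofReal ?_
          have hc : ∀ i, ((insert 0 (T i)).card : ℝ) ≤ (T i).card + 1 := fun i => by
            exact_mod_cast Finset.card_insert_le _ _
          calc _ ≤ (((T (j + 1)).card : ℝ) + 1) * ((T j).card + 1) *
                Real.exp (-(M ^ 2 * B ^ (j + 1)) / (2 * s ^ 2)) := by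
                gcongr
                · exact hc _
                · exact hc _
            _ ≤ Real.exp (-(L * B ^ (j + 1))) :=
                card_mul_tail_le hs hL (one_le_pow₀ hB1.le)
                  (pow_le_pow_right₀ hB1.le (Nat.le_succ j)) (hcard _) (Nat.cast_nonneg _)
                  (hcard _)
            _ ≤ Real.exp (-(L * ((j + 1 : ℕ) * (B - 1)))) := by
                have := one_add_mul_sub_le_pow (a := B) (by linarith) (j + 1)
                gcongr
                linarith
            _ = ρ * ρ ^ j := by
                rw [← pow_succ', hρ, ← Real.exp_nat_mul]
                ring_nf
  have hsub : {ω | ∃ x ∈ S, 2 * M * 2 ^ q * 2 ^ (1 - q) / (1 - 2 ^ q / 2) * D ^ q *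
      ‖x‖ ^ (1 - q) < inner ℝ (ε ω) x} ⊆ ⋃ j, bad j := by
    intro ω hω
    obtain ⟨x, hx, hlt⟩ := hω
    by_contra hnot
    refine absurd (inner_le_of_increments_le hq1 hM0 hD hS (T := fun j => (T j : Set V)) hT
      ?_ hx) (not_le.2 hlt)
    intro j a ha b hb hab
    by_contra hgt
    refine hnot (Set.mem_iUnion.2 ⟨j, ?_⟩)
    simp only [bad, Set.mem_iUnion]
    refine ⟨a, by simpa using ha, b, by simpa using hb, hab, (not_le.1 hgt).le⟩
  calc P _ ≤ P (⋃ j, bad j) := measure_mono hsub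
    _ ≤ ∑' j, P (bad j) := measure_iUnion_le _
    _ ≤ ∑' j, ENNReal.ofReal (ρ * ρ ^ j) := ENNReal.tsum_le_tsum hbad
    _ = ENNReal.ofReal (∑' j, ρ * ρ ^ j) :=
        (ENNReal.ofReal_tsum_of_nonneg (fun j => by positivity)
          ((summable_geometric_of_lt_one hρ0.le (by linarith)).mul_left ρ)).symm
    _ ≤ ENNReal.ofReal η := by
        refine ENNReal.ofReal_le_ofReal ?_
        rw [tsum_mul_left, tsum_geometric_of_lt_one hρ0.le (by linarith)]
        have h1 : (1 - ρ)⁻¹ ≤ 2 := by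
          rw [inv_le_comm₀ (by linarith) two_pos]
          linarith
        have h2 : ρ ≤ η / 2 := hLη.trans (min_le_right _ _)
        nlinarith

/-! ### The penalty and its unit ball -/

section Geometry

variable {r n : ℕ} {Δ : Matrix (Fin r) (Fin n) ℝ}

lemma l1_nonneg (x : EuclideanSpace ℝ (Fin n)) : 0 ≤ l1 Δ x :=
  Finset.sum_nonneg fun _ _ => abs_nonneg _

lemma l1_sub_le (x y : EuclideanSpace ℝ (Fin n)) : l1 Δ (x - y) ≤ l1 Δ x + l1 Δ y := by
  simp only [l1, ← Finset.sum_add_distrib, WithLp.ofLp_sub, Matrix.mulVec_sub, Pi.sub_apply]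
  exact Finset.sum_le_sum fun _ _ => abs_sub _ _

lemma l1_smul (t : ℝ) (x : EuclideanSpace ℝ (Fin n)) : l1 Δ (t • x) = |t| * l1 Δ x := by
  simp [l1, Matrix.mulVec_smul, abs_mul, Finset.mul_sum]

lemma smul_mem_rowBall {x : EuclideanSpace ℝ (Fin n)} {t : ℝ} (ht : |t| ≤ 1)
    (hx : x ∈ rowBall Δ 1) : t • x ∈ rowBall Δ 1 := by
  refine ⟨Submodule.smul_mem _ t hx.1, ?_⟩
  rw [l1_smul]
  exact mul_le_one₀ ht (l1_nonneg x) hx.2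

variable (Δ) in
/-- The row space of `Δ`, as a subspace of Euclidean space. -/
def rowSpace : Submodule ℝ (EuclideanSpace ℝ (Fin n)) :=
  (Submodule.span ℝ (Set.range Δ.row)).comap
    (WithLp.linearEquiv 2 ℝ (Fin n → ℝ)).toLinearMap

lemma mulVec_eq_zero_of_mem_orthogonal_rowSpace {x : EuclideanSpace ℝ (Fin n)}
    (hx : x ∈ (rowSpace Δ)ᗮ) : Δ.mulVec x.ofLp = 0 := by
  ext i
  have h1 : WithLp.toLp 2 (Δ.row i) ∈ rowSpace Δ :=
    Submodule.subset_span (Set.mem_range_self i)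
  have h2 := (Submodule.mem_orthogonal _ _).1 hx _ h1
  rw [real_inner_comm, EuclideanSpace.inner_eq_star_dotProduct] at h2
  simpa [Matrix.mulVec, dotProduct, Matrix.row] using h2

lemma finrank_orthogonal_rowSpace_le : Module.finrank ℝ (rowSpace Δ)ᗮ ≤ nullity Δ := by
  have h : ((rowSpace Δ)ᗮ).map (WithLp.linearEquiv 2 ℝ (Fin n → ℝ)).toLinearMap
      ≤ LinearMap.ker Δ.mulVecLin := by
    rintro _ ⟨x, hx, rfl⟩
    exact mulVec_eq_zero_of_mem_orthogonal_rowSpace hx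
  have h2 := LinearEquiv.finrank_map_eq (WithLp.linearEquiv 2 ℝ (Fin n → ℝ)) ((rowSpace Δ)ᗮ)
  rw [← h2]
  exact Submodule.finrank_mono h

lemma l1_starProjection_rowSpace (x : EuclideanSpace ℝ (Fin n)) :
    l1 Δ ((rowSpace Δ).starProjection x) = l1 Δ x := by
  have h : Δ.mulVec (x - (rowSpace Δ).starProjection x).ofLp = 0 :=
    mulVec_eq_zero_of_mem_orthogonal_rowSpace (Submodule.sub_starProjection_mem_orthogonal x)
  rw [WithLp.ofLp_sub, Matrix.mulVec_sub, sub_eq_zero] at h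
  rw [l1, l1, h]

/-- Rescaling the row-space part of a vector into the unit ball of the penalty. -/
lemma smul_starProjection_mem_rowBall {x : EuclideanSpace ℝ (Fin n)} {m : ℝ} (hm : 0 < m)
    (hx : l1 Δ x ≤ m) : m⁻¹ • (rowSpace Δ).starProjection x ∈ rowBall Δ 1 := by
  refine ⟨Submodule.smul_mem _ _ (Submodule.starProjection_apply_mem (rowSpace Δ) x), ?_⟩
  rw [l1_smul, l1_starProjection_rowSpace, abs_of_pos (inv_pos.2 hm), inv_mul_le_one₀ hm]
  exact hx

lemma fracSup_le_ofReal_iff {p K : ℝ} (hK : 0 ≤ K) {e : EuclideanSpace ℝ (Fin n)} :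
    fracSup Δ p e ≤ ENNReal.ofReal K ↔ ∀ x ∈ rowBall Δ 1, inner ℝ e x ≤ K * ‖x‖ ^ p := by
  simp only [fracSup, iSup_le_iff]
  refine forall₂_congr fun x _ => ?_
  rw [ENNReal.ofReal_le_ofReal_iff hK]
  rcases eq_or_ne x 0 with rfl | hx
  · have : 0 ≤ K * ‖(0 : EuclideanSpace ℝ (Fin n))‖ ^ p := by positivity
    simpa [hK] using this
  · rw [div_le_iff₀ (Real.rpow_pos_of_pos (norm_pos_iff.2 hx) p)]

end Geometry

/-! ### Consequences of the entropy bound -/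

section Entropy

variable {r n : ℕ} {Δ : Matrix (Fin r) (Fin n) ℝ}

lemma exists_finset_of_entropy_le {δ : ℝ≥0} {A : Set (EuclideanSpace ℝ (Fin n))} {a : ℝ}
    (h : entropy δ A ≤ (a : EReal)) :
    ∃ T : Finset (EuclideanSpace ℝ (Fin n)), (T.card : ℝ) ≤ Real.exp a ∧
      ∀ x ∈ A, ∃ t ∈ T, ‖x - t‖ ≤ δ := by
  have h1 : ((Metric.externalCoveringNumber δ A : ℕ∞) : ℝ≥0∞) ≤ ENNReal.ofReal (Real.exp a) := by
    rw [← ENNReal.log_le_log_iff, ENNReal.log_ofReal_of_pos (Real.exp_pos a), Real.log_exp]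
    exact h
  have htop : Metric.externalCoveringNumber δ A ≠ ⊤ := by
    intro htop
    rw [htop] at h1
    simp at h1
  obtain ⟨C, hC, hcard⟩ : ∃ C, Metric.IsCover δ A C ∧
      C.encard < Metric.externalCoveringNumber δ A + 1 := by
    have hlt : Metric.externalCoveringNumber δ A < Metric.externalCoveringNumber δ A + 1 :=
      (ENat.lt_add_one_iff htop).2 le_rfl
    conv_lhs at hlt => rw [Metric.externalCoveringNumber]
    simpa only [iInf_lt_iff, exists_prop] using hlt
  have hle : C.encard ≤ Metric.externalCoveringNumber δ A := (ENat.lt_add_one_iff htop).1 hcard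
  have hfin : C.Finite := Set.finite_of_encard_le_coe
    (hle.trans (ENat.natCast_toNat htop).ge)
  refine ⟨hfin.toFinset, ?_, fun x hx => ?_⟩
  · rw [hfin.encard_eq_coe_toFinset_card] at hle
    have h2 : ((hfin.toFinset.card : ℕ∞) : ℝ≥0∞) ≤ ENNReal.ofReal (Real.exp a) :=
      le_trans (by exact_mod_cast hle) h1
    rw [ENat.toENNReal_coe, ← ENNReal.ofReal_natCast,
      ENNReal.ofReal_le_ofReal_iff (Real.exp_pos a).le] at h2
    exact h2
  · obtain ⟨t, ht, hxt⟩ := hC hx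
    refine ⟨t, by simpa using ht, ?_⟩
    have hxt' : edist x t ≤ δ := hxt
    rw [← dist_eq_norm, dist_nndist]
    rw [edist_nndist] at hxt'
    exact_mod_cast hxt'

/-- If the entropy is below `log 2`, a single ball covers; by symmetry it may be centered at `0`. -/
lemma norm_le_of_entropy_le_half {δ : ℝ≥0} {a : ℝ} (ha : a ≤ 1 / 2)
    (h : entropy δ (rowBall Δ 1) ≤ (a : EReal)) {x : EuclideanSpace ℝ (Fin n)}
    (hx : x ∈ rowBall Δ 1) : ‖x‖ ≤ δ := by
  obtain ⟨T, hcard, hT⟩ := exists_finset_of_entropy_le h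
  have h1 : T.card ≤ 1 := by
    have h2 : Real.exp a < 2 := by
      have : Real.exp a ^ 2 < 2 ^ 2 := by
        rw [← Real.exp_nat_mul]
        have : Real.exp ((2 : ℕ) * a) ≤ Real.exp 1 :=
          Real.exp_le_exp.2 (by push_cast; linarith)
        linarith [Real.exp_one_lt_d9]
      exact lt_of_pow_lt_pow_left₀ 2 (by norm_num) this
    have h3 : (T.card : ℝ) < 2 := hcard.trans_lt h2
    have h4 : T.card < 2 := by exact_mod_cast h3
    omega
  have hneg : -x ∈ rowBall Δ 1 := by
    have := smul_mem_rowBall (t := -1) (by simp) hx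
    simpa using this
  obtain ⟨t, ht, hxt⟩ := hT x hx
  obtain ⟨t', ht', hxt'⟩ := hT _ hneg
  rw [Finset.card_le_one.1 h1 t' ht' t ht] at hxt'
  have e1 : (2 : ℝ) • x = (x - t) - (-x - t) := by
    rw [two_smul]
    abel
  have e2 : ‖(2 : ℝ) • x‖ = 2 * ‖x‖ := by simp [norm_smul]
  have e3 := norm_sub_le (x - t) (-x - t)
  rw [← e1, e2] at e3
  linarith

/-- Bounded covering numbers at arbitrarily fine scales leave no room for a segment: for a
nonpositive exponent the ball is a single point. -/
lemma eq_zero_of_mem_rowBall_of_nonpos {w E : ℝ} (hw : w ≤ 0) (hn : 0 < n)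
    (hE : ∀ δ : ℝ≥0, 0 < δ → entropy δ (rowBall Δ 1)
      ≤ ((E * (Real.sqrt n / (δ : ℝ)) ^ w : ℝ) : EReal))
    {x : EuclideanSpace ℝ (Fin n)} (hx : x ∈ rowBall Δ 1) : x = 0 := by
  by_contra hx0
  have hxpos : 0 < ‖x‖ := norm_pos_iff.2 hx0
  have hnpos : 0 < Real.sqrt n := Real.sqrt_pos.2 (by exact_mod_cast hn)
  obtain ⟨m, hm⟩ := exists_nat_gt (Real.exp |E|)
  have hmpos : (0 : ℝ) < m := (Real.exp_pos _).trans hm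
  set δ : ℝ := min (Real.sqrt n) (‖x‖ / (3 * m)) with hδ
  have hδ0 : 0 < δ := lt_min hnpos (by positivity)
  obtain ⟨T, hcard, hT⟩ := exists_finset_of_entropy_le (hE ⟨δ, hδ0.le⟩ hδ0)
  have hle : E * (Real.sqrt n / δ) ^ w ≤ |E| := by
    have h1 : (Real.sqrt n / δ) ^ w ≤ 1 :=
      Real.rpow_le_one_of_one_le_of_nonpos ((one_le_div hδ0).2 (min_le_left _ _)) hw
    have h2 : 0 ≤ (Real.sqrt n / δ) ^ w := by positivity
    calc E * (Real.sqrt n / δ) ^ w ≤ |E| * (Real.sqrt n / δ) ^ w := by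
          gcongr
          exact le_abs_self E
      _ ≤ |E| * 1 := by gcongr
      _ = |E| := mul_one _
  have hcard' : T.card < m := by
    have : (T.card : ℝ) < m := (hcard.trans (Real.exp_le_exp.2 hle)).trans_lt hm
    exact_mod_cast this
  have hmem : ∀ i : Fin m, ((i : ℝ) / m) • x ∈ rowBall Δ 1 := by
    intro i
    refine smul_mem_rowBall ?_ hx
    rw [abs_of_nonneg (by positivity), div_le_one hmpos]
    exact_mod_cast i.2.le
  choose c hcT hc using fun i => hT _ (hmem i)
  obtain ⟨i, -, j, -, hij, hcij⟩ := Finset.exists_ne_map_eq_of_card_lt_of_maps_to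
    (s := Finset.univ) (t := T) (f := c) (by simpa using hcard') (fun i _ => hcT i)
  have h1 := hc i
  have h2 := hc j
  rw [hcij] at h1
  have e1 : ((i : ℝ) / m) • x - ((j : ℝ) / m) • x = (((i : ℝ) - j) / m) • x := by
    rw [← sub_smul, sub_div]
  have e2 : (((i : ℝ) - j) / m) • x
      = (((i : ℝ) / m) • x - c j) - (((j : ℝ) / m) • x - c j) := by
    rw [← e1]
    abel
  have e3 := norm_sub_le (((i : ℝ) / m) • x - c j) (((j : ℝ) / m) • x - c j)
  rw [← e2, norm_smul, Real.norm_eq_abs, abs_div, abs_of_pos hmpos] at e3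
  have e4 : (1 : ℝ) ≤ |(i : ℝ) - j| := by
    have h3 : ((i : ℕ) : ℤ) - ((j : ℕ) : ℤ) ≠ 0 := by
      rw [sub_ne_zero]
      exact_mod_cast fun h => hij (Fin.ext h)
    exact_mod_cast Int.one_le_abs h3
  have e5 : δ ≤ ‖x‖ / (3 * m) := min_le_right _ _
  have e6 : 1 / m * ‖x‖ ≤ |(i : ℝ) - j| / m * ‖x‖ := by gcongr
  have e7 : ‖x‖ / (3 * m) = 1 / 3 * (1 / m * ‖x‖) := by
    field_simp
  have e8 : 0 < 1 / m * ‖x‖ := by positivity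
  change ‖_‖ ≤ δ at h1
  change ‖_‖ ≤ δ at h2
  linarith

/-- A nontrivial penalty forces a positive exponent and a positive entropy constant. -/
lemma exponent_pos_and_const_pos {w E : ℝ} (hn : 0 < n)
    (hE : ∀ δ : ℝ≥0, 0 < δ → entropy δ (rowBall Δ 1)
      ≤ ((E * (Real.sqrt n / (δ : ℝ)) ^ w : ℝ) : EReal))
    (hΔ : ∃ x ∈ rowBall Δ 1, x ≠ 0) : 0 < w ∧ 0 < E := by
  obtain ⟨x, hx, hx0⟩ := hΔ
  have hw : 0 < w := by
    by_contra hw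
    exact hx0 (eq_zero_of_mem_rowBall_of_nonpos (not_lt.1 hw) hn hE hx)
  refine ⟨hw, ?_⟩
  by_contra hE0
  have hxpos : 0 < ‖x‖ := norm_pos_iff.2 hx0
  have h1 := hE (‖x‖₊ / 2) (half_pos hxpos)
  have h2 : 0 ≤ (Real.sqrt n / ((‖x‖₊ / 2 : ℝ≥0) : ℝ)) ^ w := by positivity
  have h3 := norm_le_of_entropy_le_half
    ((mul_nonpos_of_nonpos_of_nonneg (not_lt.1 hE0) h2).trans (by norm_num)) h1 hx
  rw [NNReal.coe_div, coe_nnnorm, NNReal.coe_ofNat] at h3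
  linarith

lemma exists_mem_rowBall_ne_zero {x : EuclideanSpace ℝ (Fin n)} (hx : l1 Δ x ≠ 0) :
    ∃ y ∈ rowBall Δ 1, y ≠ 0 := by
  have hpos : 0 < l1 Δ x := (l1_nonneg x).lt_of_ne' hx
  refine ⟨_, smul_starProjection_mem_rowBall hpos le_rfl, fun h => hx ?_⟩
  rw [smul_eq_zero, or_iff_right (inv_ne_zero hx)] at h
  rw [← l1_starProjection_rowSpace, h]
  simp [l1]

end Entropy

/-! ### The fractional bound for one sample size -/

/-- The scale `D = √n (2 E) ^ (1 / w)` is the one at which the entropy bound equals `1 / 2 < log 2`,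
so the whole unit ball of the penalty has norm at most `D`, and the entropy at scale `D 2⁻ʲ` is at
most `2 ^ (w j) / 2`. The constant does not depend on `n`. -/
lemma exists_const_measure_fracSup_gt_le {w σ η : ℝ} (hw0 : 0 < w) (hw : w < 2) (hη : 0 < η) :
    ∃ C : ℝ, 0 < C ∧ ∀ {Ω : Type*} [MeasurableSpace Ω] (P : Measure Ω) [IsProbabilityMeasure P]
      {r n : ℕ} (_ : 0 < n) (Δ : Matrix (Fin r) (Fin n) ℝ) (ε : Ω → EuclideanSpace ℝ (Fin n))
      (_ : HasLaw ε (multivariateGaussian 0 (σ ^ 2 • (1 : Matrix (Fin n) (Fin n) ℝ))) P)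
      (E : ℝ) (_ : 0 < E)
      (_ : ∀ δ : ℝ≥0, 0 < δ → entropy δ (rowBall Δ 1)
        ≤ ((E * (Real.sqrt n / (δ : ℝ)) ^ w : ℝ) : EReal)),
      P {ω | ENNReal.ofReal (C * (Real.sqrt E * (n : ℝ) ^ (w / 4))) < fracSup Δ (1 - w / 2) (ε ω)}
        ≤ ENNReal.ofReal η := by
  obtain ⟨C, hC, hchain⟩ := exists_const_measure_inner_gt_le (q := w / 2) (s := |σ| + 1)
    (by linarith) (by linarith) (by positivity) hη
  refine ⟨C * Real.sqrt 2, by positivity, ?_⟩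
  intro Ω _ P _ r n hn Δ ε hε E hE hent
  have hnpos : (0 : ℝ) < n := by exact_mod_cast hn
  set D : ℝ := Real.sqrt n * (2 * E) ^ (1 / w) with hD
  have hD0 : 0 < D := by positivity
  have hscale : ∀ j : ℕ, E * (Real.sqrt n / (D * (1 / 2) ^ j)) ^ w = ((2 : ℝ) ^ w) ^ j / 2 := by
    intro j
    have e1 : Real.sqrt n / (D * (1 / 2) ^ j) = 2 ^ j * ((2 * E) ^ (1 / w))⁻¹ := by
      rw [hD, div_pow, one_pow]
      field_simp
    have e2 : ((2 * E) ^ (1 / w)) ^ w = 2 * E := by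
      rw [← Real.rpow_mul (by positivity), one_div_mul_cancel hw0.ne', Real.rpow_one]
    have e3 : ((2 : ℝ) ^ j) ^ w = ((2 : ℝ) ^ w) ^ j := by
      rw [← Real.rpow_natCast, ← Real.rpow_natCast, ← Real.rpow_mul two_pos.le,
        ← Real.rpow_mul two_pos.le, mul_comm]
    rw [e1, Real.mul_rpow (by positivity) (by positivity), Real.inv_rpow (by positivity), e2, e3]
    field_simp
  have hcov : ∀ j : ℕ, entropy (D * (1 / 2) ^ j).toNNReal (rowBall Δ 1)
      ≤ ((((2 : ℝ) ^ w) ^ j / 2 : ℝ) : EReal) := by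
    intro j
    have hpos : 0 < D * (1 / 2) ^ j := by positivity
    have := hent (D * (1 / 2) ^ j).toNNReal (Real.toNNReal_pos.2 hpos)
    rwa [Real.coe_toNNReal _ hpos.le, hscale] at this
  have hball : ∀ x ∈ rowBall Δ 1, ‖x‖ ≤ D := by
    intro x hx
    have := norm_le_of_entropy_le_half (by simp) (hcov 0) hx
    rw [Real.coe_toNNReal _ (by positivity)] at this
    simpa using this
  choose T hTcard hT using fun j => exists_finset_of_entropy_le (hcov j)
  have hDq : D ^ (w / 2) = Real.sqrt 2 * (Real.sqrt E * (n : ℝ) ^ (w / 4)) := by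
    rw [hD, Real.mul_rpow (by positivity) (by positivity), ← Real.rpow_mul (by positivity),
      Real.sqrt_eq_rpow n, ← Real.rpow_mul hnpos.le, show 1 / w * (w / 2) = 1 / 2 by field_simp,
      show 1 / 2 * (w / 2) = w / 4 by ring, Real.mul_rpow two_pos.le hE.le,
      ← Real.sqrt_eq_rpow, ← Real.sqrt_eq_rpow]
    ring
  have hmain := hchain P ε
    (fun v ρ u hρ hu hv => measure_le_inner_gaussian hε (by positivity) (by linarith) hρ hu hv)
    D hD0 (rowBall Δ 1) hball T (fun j => ?_) (fun j x hx => ?_)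
  · refine (measure_mono fun ω hω => ?_).trans hmain
    have h := (fracSup_le_ofReal_iff (by positivity)).not.1 (not_le.2 hω)
    push Not at h
    obtain ⟨x, hx, hlt⟩ := h
    refine ⟨x, hx, ?_⟩
    rw [hDq, ← mul_assoc C]
    exact hlt
  · refine (hTcard j).trans (Real.exp_le_exp.2 ?_)
    rw [mul_div_cancel₀ w two_ne_zero]
    exact half_le_self (by positivity)
  · obtain ⟨t, ht, hxt⟩ := hT j x hx
    rw [Real.coe_toNNReal _ (by positivity)] at hxt
    exact ⟨t, ht, hxt⟩

/-! ### From the fractional bound to the error of the estimate -/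

/-- The basic inequality of the generalized lasso. The noise is split along the row space of `Δ`,
where the fractional bound applies after rescaling, and its orthogonal complement. -/
lemma basic_inequality {r n : ℕ} {Δ : Matrix (Fin r) (Fin n) ℝ} {q K lam : ℝ} (hq1 : q < 1)
    (hK : 0 ≤ K) {β₀ e b : EuclideanSpace ℝ (Fin n)} (hβ : 0 < l1 Δ β₀)
    (he : fracSup Δ (1 - q) e ≤ ENNReal.ofReal K) (hb : IsEstimate Δ lam (β₀ + e) b) :
    1 / 2 * ‖b - β₀‖ ^ 2 ≤ ‖(rowSpace Δ)ᗮ.starProjection e‖ * ‖b - β₀‖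
      + K * ‖b - β₀‖ ^ (1 - q) * (l1 Δ β₀ + l1 Δ b) ^ q + lam * (l1 Δ β₀ - l1 Δ b) := by
  set h := b - β₀ with hh
  set m := l1 Δ β₀ + l1 Δ b with hm
  have hm0 : 0 < m := add_pos_of_pos_of_nonneg hβ (l1_nonneg b)
  have hopt := isMinOn_iff.1 hb β₀ (Set.mem_univ _)
  rw [add_sub_cancel_left, show β₀ + e - b = e - h by rw [hh]; abel, norm_sub_sq_real] at hopt
  have hsplit : inner ℝ e h = inner ℝ e ((rowSpace Δ).starProjection h)
      + inner ℝ ((rowSpace Δ)ᗮ.starProjection e) h := by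
    rw [Submodule.inner_starProjection_left_eq_right, ← inner_add_right]
    congr 1
    exact ((rowSpace Δ).starProjection_add_starProjection_orthogonal h).symm
  have hnull : inner ℝ ((rowSpace Δ)ᗮ.starProjection e) h
      ≤ ‖(rowSpace Δ)ᗮ.starProjection e‖ * ‖h‖ := real_inner_le_norm _ _
  have hrow : inner ℝ e ((rowSpace Δ).starProjection h) ≤ K * ‖h‖ ^ (1 - q) * m ^ q := by
    have hmem := smul_starProjection_mem_rowBall hm0
      ((l1_sub_le (Δ := Δ) b β₀).trans_eq (add_comm _ _))
    have h1 := (fracSup_le_ofReal_iff hK).1 he _ hmem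
    rw [inner_smul_right, norm_smul, Real.norm_eq_abs, abs_of_pos (inv_pos.2 hm0),
      inv_mul_le_iff₀ hm0, Real.mul_rpow (inv_pos.2 hm0).le (norm_nonneg _)] at h1
    have h2 : m * (m⁻¹) ^ (1 - q) = m ^ q := by
      rw [Real.inv_rpow hm0.le, ← Real.rpow_neg hm0.le]
      nth_rw 1 [← Real.rpow_one m]
      rw [← Real.rpow_add hm0]
      congr 1
      ring
    have h3 : ‖(rowSpace Δ).starProjection h‖ ^ (1 - q) ≤ ‖h‖ ^ (1 - q) :=
      Real.rpow_le_rpow (norm_nonneg _) (Submodule.norm_starProjection_apply_le _ _) (by linarith)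
    calc _ ≤ _ := h1
      _ = K * ‖(rowSpace Δ).starProjection h‖ ^ (1 - q) * (m * (m⁻¹) ^ (1 - q)) := by ring
      _ ≤ K * ‖h‖ ^ (1 - q) * m ^ q := by
        rw [h2]
        gcongr
  linarith

/-- Young's inequality with a small weight on the second factor. -/
lemma exists_const_mul_rpow_le {q C c : ℝ} (hq0 : 0 < q) (hq1 : q < 1) (hC : 0 < C) (hc : 0 < c) :
    ∃ A : ℝ, 0 < A ∧ ∀ U M : ℝ, 0 ≤ U → 0 ≤ M → C * (U ^ (1 - q) * M ^ q) ≤ A * U + c * M := by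
  set θ := c / C with hθ
  have hθ0 : 0 < θ := by positivity
  refine ⟨C * θ ^ (-q / (1 - q)), by positivity, fun U M hU hM => ?_⟩
  have h1q : 0 < 1 - q := by linarith
  have h := Real.geom_mean_le_arith_mean2_weighted (w₁ := 1 - q) (w₂ := q)
    (p₁ := θ ^ (-q / (1 - q)) * U) (p₂ := θ * M) h1q.le hq0.le (by positivity) (by positivity)
    (by ring)
  have e1 : (θ ^ (-q / (1 - q)) * U) ^ (1 - q) * (θ * M) ^ q = U ^ (1 - q) * M ^ q := by
    rw [Real.mul_rpow (by positivity) hU, Real.mul_rpow hθ0.le hM, ← Real.rpow_mul hθ0.le,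
      div_mul_cancel₀ _ h1q.ne', Real.rpow_neg hθ0.le]
    have : θ ^ q ≠ 0 := by positivity
    field_simp
  rw [e1] at h
  have e2 : (1 - q) * (θ ^ (-q / (1 - q)) * U) ≤ θ ^ (-q / (1 - q)) * U :=
    mul_le_of_le_one_left (by positivity) (by linarith)
  have e3 : q * (θ * M) ≤ θ * M := mul_le_of_le_one_left (by positivity) hq1.le
  calc C * (U ^ (1 - q) * M ^ q) ≤ C * (θ ^ (-q / (1 - q)) * U + θ * M) := by
        gcongr
        linarith
    _ = C * θ ^ (-q / (1 - q)) * U + c * M := by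
        rw [hθ]
        field_simp

/-- Solving the basic inequality when `lam * a` is of the order of the rate `R`. Young's inequality
is applied to `√R u` and `R (a + b) / a`, with so small a weight on the second that the part that
grows with `b` is absorbed by the penalty. -/
lemma exists_const_sq_le {q C c₁ c₂ : ℝ} (hq0 : 0 < q) (hq1 : q < 1) (hC : 0 < C) (hc₁ : 0 < c₁)
    (hc₂ : 0 < c₂) :
    ∃ C' : ℝ, 0 < C' ∧ ∀ g R a b u lam : ℝ, 0 < R → 0 < a → 0 ≤ b → 0 ≤ u →
      c₁ * R ≤ lam * a → lam * a ≤ c₂ * R →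
      1 / 2 * u ^ 2 ≤ g * u + C * (R ^ ((1 + q) / 2) * a ^ (-q)) * u ^ (1 - q) * (a + b) ^ q
        + lam * (a - b) →
      u ^ 2 ≤ 8 * g ^ 2 + C' * R := by
  obtain ⟨A, hA, hyoung⟩ := exists_const_mul_rpow_le hq0 hq1 hC hc₁
  refine ⟨8 * A ^ 2 + 4 * (c₁ + c₂), by positivity, ?_⟩
  intro g R a b u lam hR ha hb hu h₁ h₂ hmain
  have hy := hyoung (√R * u) (R * (a + b) / a) (by positivity) (by positivity)
  have e1 : C * (R ^ ((1 + q) / 2) * a ^ (-q)) * u ^ (1 - q) * (a + b) ^ q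
      = C * ((√R * u) ^ (1 - q) * (R * (a + b) / a) ^ q) := by
    rw [Real.div_rpow (by positivity) ha.le, Real.mul_rpow hR.le (by positivity),
      Real.mul_rpow (by positivity) hu, Real.sqrt_eq_rpow, ← Real.rpow_mul hR.le,
      Real.rpow_neg ha.le, show (1 + q) / 2 = 1 / 2 * (1 - q) + q by ring, Real.rpow_add hR]
    ring
  rw [e1] at hmain
  have e2 : c₁ * (R * (a + b) / a) = c₁ * R + c₁ * R / a * b := by
    field_simp
  have e3 : c₁ * R / a * b ≤ lam * b := by
    gcongr
    rwa [div_le_iff₀ ha]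
  have e4 : √R ^ 2 = R := Real.sq_sqrt hR.le
  nlinarith [sq_nonneg (u - 2 * (g + A * √R)), sq_nonneg (g - A * √R)]

/-! ### Exponents of the rate -/

lemma rate_eq_tuning_mul {w E a : ℝ} {n : ℕ} (hw0 : 0 < w) (ha : 0 < a) :
    E ^ (1 / (1 + w / 2)) * (n : ℝ) ^ ((w / 2) / (1 + w / 2)) * a ^ (w / (1 + w / 2))
      = E ^ (1 / (1 + w / 2)) * (n : ℝ) ^ ((w / 2) / (1 + w / 2))
        * a ^ (-((1 - w / 2) / (1 + w / 2))) * a := by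
  rw [mul_assoc _ (a ^ (-((1 - w / 2) / (1 + w / 2))))]
  congr 1
  nth_rw 3 [← Real.rpow_one a]
  rw [← Real.rpow_add ha]
  congr 1
  field_simp
  ring

lemma sqrt_mul_rpow_eq_rate_rpow {w E a : ℝ} {n : ℕ} (hw0 : 0 < w) (hE : 0 < E) (ha : 0 < a) :
    √E * (n : ℝ) ^ (w / 4)
      = (E ^ (1 / (1 + w / 2)) * (n : ℝ) ^ ((w / 2) / (1 + w / 2)) * a ^ (w / (1 + w / 2)))
        ^ ((1 + w / 2) / 2) * a ^ (-(w / 2)) := by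
  have hn : (0 : ℝ) ≤ n := Nat.cast_nonneg n
  rw [Real.mul_rpow (by positivity) (by positivity), Real.mul_rpow (by positivity) (by positivity),
    ← Real.rpow_mul hE.le, ← Real.rpow_mul hn, ← Real.rpow_mul ha.le, mul_assoc,
    ← Real.rpow_add ha, Real.sqrt_eq_rpow]
  have e1 : 1 / (1 + w / 2) * ((1 + w / 2) / 2) = 1 / 2 := by field_simp
  have e2 : w / 2 / (1 + w / 2) * ((1 + w / 2) / 2) = w / 4 := by field_simp; norm_num
  have e3 : w / (1 + w / 2) * ((1 + w / 2) / 2) + -(w / 2) = 0 := by field_simp; ring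
  rw [e1, e2, e3, Real.rpow_zero, mul_one]

lemma rate_div {w E a : ℝ} {n : ℕ} (hw0 : 0 < w) (hn : 0 < n) :
    E ^ (1 / (1 + w / 2)) * (n : ℝ) ^ (-(1 / (1 + w / 2))) * a ^ (w / (1 + w / 2))
      = E ^ (1 / (1 + w / 2)) * (n : ℝ) ^ ((w / 2) / (1 + w / 2)) * a ^ (w / (1 + w / 2)) / n := by
  have hn' : (0 : ℝ) < n := by exact_mod_cast hn
  have e : (n : ℝ) ^ (-(1 / (1 + w / 2))) = (n : ℝ) ^ ((w / 2) / (1 + w / 2)) / n := by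
    rw [eq_div_iff hn'.ne']
    nth_rw 2 [← Real.rpow_one (n : ℝ)]
    rw [← Real.rpow_add hn']
    congr 1
    field_simp
    ring
  rw [e]
  ring

/-! ### The two bounds in probability -/

lemma exists_real_pos_ofReal_le {η : ℝ≥0∞} (hη : 0 < η) :
    ∃ x : ℝ, 0 < x ∧ ENNReal.ofReal x ≤ η := by
  obtain ⟨x, hx0, hx⟩ := ENNReal.lt_iff_exists_nnreal_btwn.1 hη
  refine ⟨x, by exact_mod_cast hx0, ?_⟩
  rw [ENNReal.ofReal_coe_nnreal]
  exact hx.le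

end GenLasso

open GenLasso in
theorem theorem3
    -- one regression problem for each sample size `n`
    {Ω : ℕ → Type*} [∀ n, MeasurableSpace (Ω n)] (P : ∀ n, Measure (Ω n))
    [∀ n, IsProbabilityMeasure (P n)]
    (r : ℕ → ℕ) (Δ : ∀ n, Matrix (Fin (r n)) (Fin n) ℝ)
    -- the noise `ε ∼ N(0, σ² I)`
    (σ : ℝ) (ε : ∀ n, Ω n → EuclideanSpace ℝ (Fin n))
    (hε : ∀ n, HasLaw (ε n)
      (multivariateGaussian 0 (σ ^ 2 • (1 : Matrix (Fin n) (Fin n) ℝ))) (P n))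
    -- the entropy bound
    (w : ℝ) (hw : w < 2) (E : ℕ → ℝ)
    (hE : ∀ᶠ n in atTop, ∀ δ : ℝ≥0, 0 < δ →
      GenLasso.entropy δ (GenLasso.rowBall (Δ n) 1)
        ≤ ((E n * (Real.sqrt n / (δ : ℝ)) ^ w : ℝ) : EReal)) :
    -- the fractional bound
    GenLasso.IsBigOP P (fun n ω => GenLasso.fracSup (Δ n) (1 - w / 2) (ε n ω))
      (fun n => Real.sqrt (E n) * (n : ℝ) ^ (w / 4)) ∧
    -- the error rate of the generalized lasso with data `y = β₀ + ε`
    ∀ (β₀ : ∀ n, EuclideanSpace ℝ (Fin n)) (lam : ℕ → ℝ)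
      (βhat : ∀ n, Ω n → EuclideanSpace ℝ (Fin n)),
      (∀ᶠ n in atTop, GenLasso.l1 (Δ n) (β₀ n) ≠ 0) →
      (∀ n, 0 ≤ lam n) →
      lam =Θ[atTop] (fun n => E n ^ (1 / (1 + w / 2)) * (n : ℝ) ^ ((w / 2) / (1 + w / 2))
        * GenLasso.l1 (Δ n) (β₀ n) ^ (-((1 - w / 2) / (1 + w / 2)))) →
      (∀ n ω, GenLasso.IsEstimate (Δ n) (lam n) (β₀ n + ε n ω) (βhat n ω)) →
      GenLasso.IsBigOP P (fun n ω => ‖βhat n ω - β₀ n‖ ^ 2 / (n : ℝ))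
        (fun n => (GenLasso.nullity (Δ n) : ℝ) / (n : ℝ)
          + E n ^ (1 / (1 + w / 2)) * (n : ℝ) ^ (-(1 / (1 + w / 2)))
            * GenLasso.l1 (Δ n) (β₀ n) ^ (w / (1 + w / 2))) := by
  constructor
  · intro η hη
    obtain ⟨η', hη'0, hη'⟩ := exists_real_pos_ofReal_le hη
    -- if the ball is trivial, so is the supremum; the value of the constant is then irrelevant
    have htriv : ∀ (C : ℝ) (n : ℕ), 0 < C → (¬ ∃ x ∈ rowBall (Δ n) 1, x ≠ 0) →
        P n {ω | ENNReal.ofReal (C * (√(E n) * (n : ℝ) ^ (w / 4)))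
          < ‖fracSup (Δ n) (1 - w / 2) (ε n ω)‖ₑ} ≤ η := by
      intro C n hC hΔ
      push Not at hΔ
      have : {ω | ENNReal.ofReal (C * (√(E n) * (n : ℝ) ^ (w / 4)))
          < ‖fracSup (Δ n) (1 - w / 2) (ε n ω)‖ₑ} = ∅ := by
        refine Set.eq_empty_of_forall_notMem fun ω hω => ?_
        rw [Set.mem_ofPred_eq] at hω
        refine not_le.2 hω ?_
        rw [enorm_eq_self]
        refine (fracSup_le_ofReal_iff (by positivity)).2 fun x hx => ?_
        rw [hΔ x hx, inner_zero_right]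
        positivity
      rw [this, measure_empty]
      exact zero_le
    rcases lt_or_ge 0 w with hw0 | hw0
    · obtain ⟨C, hC, hfrac⟩ := exists_const_measure_fracSup_gt_le (σ := σ) hw0 hw hη'0
      refine ⟨C, hC, ?_⟩
      filter_upwards [hE, eventually_gt_atTop 0] with n hEn hn
      by_cases hΔ : ∃ x ∈ rowBall (Δ n) 1, x ≠ 0
      · exact (hfrac (P n) hn (Δ n) (ε n) (hε n) (E n)
          (exponent_pos_and_const_pos hn hEn hΔ).2 hEn).trans hη'
      · exact htriv C n hC hΔ
    · refine ⟨1, one_pos, ?_⟩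
      filter_upwards [hE, eventually_gt_atTop 0] with n hEn hn
      exact htriv 1 n one_pos fun hΔ => (exponent_pos_and_const_pos hn hEn hΔ).1.not_ge hw0
  · intro β₀ lam βhat hβ hlam hΘ hest η hη
    have hpos : ∀ᶠ n in atTop, 0 < w ∧ 0 < E n := by
      filter_upwards [hE, eventually_gt_atTop 0, hβ] with n hEn hn hβn
      exact exponent_pos_and_const_pos hn hEn (exists_mem_rowBall_ne_zero hβn)
    have hw0 : 0 < w := hpos.exists.choose_spec.1
    obtain ⟨η', hη'0, hη'⟩ := exists_real_pos_ofReal_le hη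
    obtain ⟨C, hC, hfrac⟩ :=
      exists_const_measure_fracSup_gt_le (σ := σ) hw0 hw (half_pos hη'0)
    obtain ⟨c₂, hc₂, hup⟩ := hΘ.1.exists_pos
    obtain ⟨c, hc, hlow⟩ := hΘ.2.exists_pos
    obtain ⟨C', hC', hsq⟩ := exists_const_sq_le (q := w / 2) (by linarith) (by linarith) hC
      (inv_pos.2 hc) hc₂
    -- the threshold at which Markov's inequality gives the exceptional probability `η' / 2`
    set C₀ : ℝ := 2 * (σ ^ 2 + 1) / η' with hC₀
    have hC₀pos : 0 < C₀ := by positivity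
    have hC₀η : σ ^ 2 / C₀ ≤ η' / 2 := by
      rw [div_le_iff₀ hC₀pos, hC₀]
      field_simp
      linarith
    refine ⟨max (8 * C₀) C', lt_max_of_lt_right hC', ?_⟩
    filter_upwards [hE, eventually_gt_atTop 0, hβ, hpos, hup.bound, hlow.bound]
      with n hEn hn hβn hposn hupn hlown
    have hn' : (0 : ℝ) < n := by exact_mod_cast hn
    have ha : 0 < l1 (Δ n) (β₀ n) := (l1_nonneg _).lt_of_ne' hβn
    have hEpos := hposn.2
    set a := l1 (Δ n) (β₀ n)
    set F := E n ^ (1 / (1 + w / 2)) * (n : ℝ) ^ ((w / 2) / (1 + w / 2))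
        * a ^ (-((1 - w / 2) / (1 + w / 2))) with hF
    have hF0 : 0 < F := by positivity
    rw [Real.norm_of_nonneg (hlam n), Real.norm_of_nonneg hF0.le] at hupn hlown
    set R := E n ^ (1 / (1 + w / 2)) * (n : ℝ) ^ ((w / 2) / (1 + w / 2)) * a ^ (w / (1 + w / 2))
      with hR
    have hR0 : 0 < R := by positivity
    have hRF : R = F * a := rate_eq_tuning_mul hw0 ha
    have h₁ : c⁻¹ * R ≤ lam n * a := by
      rw [hRF, ← mul_assoc]
      gcongr
      rwa [inv_mul_le_iff₀ hc]
    have h₂ : lam n * a ≤ c₂ * R := by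
      rw [hRF, ← mul_assoc]
      gcongr
    set K := (rowSpace (Δ n))ᗮ
    have hdim : (Module.finrank ℝ K : ℝ) ≤ nullity (Δ n) := by
      exact_mod_cast finrank_orthogonal_rowSpace_le
    -- outside the two exceptional events the deterministic argument applies
    have hsub : {ω | ENNReal.ofReal (max (8 * C₀) C' * ((nullity (Δ n) : ℝ) / (n : ℝ)
          + E n ^ (1 / (1 + w / 2)) * (n : ℝ) ^ (-(1 / (1 + w / 2))) * a ^ (w / (1 + w / 2))))
          < ‖‖βhat n ω - β₀ n‖ ^ 2 / (n : ℝ)‖ₑ}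
        ⊆ {ω | ENNReal.ofReal (C * (√(E n) * (n : ℝ) ^ (w / 4)))
            < fracSup (Δ n) (1 - w / 2) (ε n ω)} ∪
          {ω | C₀ * Module.finrank ℝ K < ‖K.starProjection (ε n ω)‖ ^ 2} := by
      intro ω hω
      by_contra hnot
      rw [Set.mem_union, not_or] at hnot
      have hfr : fracSup (Δ n) (1 - w / 2) (ε n ω)
          ≤ ENNReal.ofReal (C * (√(E n) * (n : ℝ) ^ (w / 4))) := not_lt.1 hnot.1
      have hproj : ‖K.starProjection (ε n ω)‖ ^ 2 ≤ C₀ * Module.finrank ℝ K := not_lt.1 hnot.2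
      have hbasic := basic_inequality (by linarith) (by positivity) ha hfr (hest n ω)
      rw [sqrt_mul_rpow_eq_rate_rpow hw0 hEpos ha] at hbasic
      have hfin := hsq _ R a _ _ (lam n) hR0 ha (l1_nonneg _) (norm_nonneg _) h₁ h₂ hbasic
      rw [Set.mem_ofPred_eq] at hω
      refine not_le.2 hω ?_
      rw [Real.enorm_eq_ofReal (by positivity)]
      refine ENNReal.ofReal_le_ofReal ?_
      rw [rate_div hw0 hn, ← hR, ← add_div, ← mul_div_assoc]
      gcongr
      calc ‖βhat n ω - β₀ n‖ ^ 2 ≤ 8 * ‖K.starProjection (ε n ω)‖ ^ 2 + C' * R := hfin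
        _ ≤ 8 * C₀ * nullity (Δ n) + C' * R := by
            have : C₀ * Module.finrank ℝ K ≤ C₀ * nullity (Δ n) := by gcongr
            linarith
        _ ≤ max (8 * C₀) C' * nullity (Δ n) + max (8 * C₀) C' * R := by
            gcongr
            · exact le_max_left _ _
            · exact le_max_right _ _
        _ = _ := by ring
    calc _ ≤ P n _ := measure_mono hsub
      _ ≤ _ := measure_union_le _ _
      _ ≤ ENNReal.ofReal (η' / 2) + ENNReal.ofReal (η' / 2) := by
          refine add_le_add (hfrac (P n) hn (Δ n) (ε n) (hε n) (E n) hEpos hEn) ?_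
          exact (measure_sq_norm_proj_gaussian (hε n) K hC₀pos).trans
            (ENNReal.ofReal_le_ofReal hC₀η)
      _ = ENNReal.ofReal η' := by
          rw [← ENNReal.ofReal_add (by positivity) (by positivity), add_halves]
      _ ≤ η := hη'
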